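/- For $F:\mathbb Z^n\to\mathbb Z$ let $\Delta F(z)=-2nF(z)+\sum_{z'\sim z}F(z')$, the sum running over the $2n$ nearest neighbours $z\pm e_i$ of $z$; $F$ is superharmonic if $\Delta F\le 0$ on $\mathbb Z^n$. Let $D(F)=\{z:\Delta F(z)\ne 0\}$ be the deviation set of $F$, and for $C>0$ let $B_C(A)$ be the set of points of $\mathbb Z^n$ at Euclidean distance at most $C$ from $A\subset\mathbb Z^n$. We say that $G$ coincides with $F$ outside a finite neighbourhood of $D(F)$ if $\{F\ne G\}\subset B_C(D(F))$ for some $C>0$. For a superharmonic $F:\mathbb Z^n\to\mathbb Z$ and $k\in\mathbb Z_{\ge 0}$ put $$\Theta_k(F)=\{G:\mathbb Z^n\to\mathbb Z \mid \Delta G\le 0,\ F-k\le G\le F,\ \exists C>0:\ \{F\ne G\}\subset B_C(D(F))\},$$ and let the $k$-husking of $F$ be the function $(F)_k(z)=\min\{G(z)\mid G\in\Theta_k(F)\}$. **Theorem.** Let $p\in\mathbb Z^n$ be primitive (the greatest common divisor of its coordinates is $1$) and let $\Psi(z)=\min(0,p\cdot z)$ for $z\in\mathbb Z^n$. Then there is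 an integer $N>0$ such that 1. $(\Psi)_k=(\Psi)_N$ for all $k>N$; 2. $(\Psi)_N$ coincides with $\Psi$ outside a finite neighbourhood of $D(\Psi)$; 3. $(\Psi)_N$ is the pointwise minimal function in $\bigcup_{k\ge 0}\Theta_k(\Psi)$. More generally, it is the pointwise minimal function among all superharmonic $G:\mathbb Z^n\to\mathbb Z$ that coincide with $\Psi$ outside a finite neighbourhood of $D(\Psi)$ and for which $\Psi-G$ is bounded above; in both cases $(\Psi)_N$ itself belongs to the class. -/

import Mathlib

namespace Sandpile

/-- The discrete Laplacian on `ℤⁿ`: the sum of `F` over the `2n` nearest neighbours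
`z ± eᵢ` of `z`, minus `2n F(z)`. -/
def laplacian {n : ℕ} (F : (Fin n → ℤ) → ℤ) (z : Fin n → ℤ) : ℤ :=
  -(2 * (n : ℤ)) * F z + ∑ i : Fin n, (F (z + Pi.single i 1) + F (z - Pi.single i 1))

/-- Superharmonic on all of `ℤⁿ`. -/
def IsSuperharmonic {n : ℕ} (F : (Fin n → ℤ) → ℤ) : Prop :=
  ∀ z, laplacian F z ≤ 0

/-- The deviation set `D(F)`: the points where `F` is not harmonic. -/
def deviationSet {n : ℕ} (F : (Fin n → ℤ) → ℤ) : Set (Fin n → ℤ) :=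
  {z | laplacian F z ≠ 0}

/-- `B_C(A)`: the lattice points at Euclidean distance at most `C` from the set `A`
(distances between lattice points are discrete, so the distance to a nonempty `A` is attained). -/
noncomputable def nbhd {n : ℕ} (C : ℝ) (A : Set (Fin n → ℤ)) : Set (Fin n → ℤ) :=
  {z | ∃ a ∈ A, Real.sqrt (∑ i : Fin n, ((z i : ℝ) - (a i : ℝ)) ^ 2) ≤ C}

/-- `G` coincides with `F` outside a finite neighbourhood of `D(F)`. -/
def AgreesAtInfinity {n : ℕ} (F G : (Fin n → ℤ) → ℤ) : Prop :=
  ∃ C : ℝ, 0 < C ∧ {z | F z ≠ G z} ⊆ nbhd C (deviationSet F)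

/-- `Θ_k(F)`: the integer-valued superharmonic `G` with `F - k ≤ G ≤ F` that coincide with `F`
outside a finite neighbourhood of `D(F)`. -/
def Theta {n : ℕ} (k : ℕ) (F : (Fin n → ℤ) → ℤ) : Set ((Fin n → ℤ) → ℤ) :=
  {G | IsSuperharmonic G ∧ (∀ z, F z - (k : ℤ) ≤ G z) ∧ (∀ z, G z ≤ F z) ∧
    AgreesAtInfinity F G}

/-- The `k`-husking `(F)_k` of a superharmonic `F`: the pointwise minimum of the elements of
`Θ_k(F)`. The infimum is a minimum, see `husking_isLeast`. -/
noncomputable def husking {n : ℕ} (k : ℕ) (F : (Fin n → ℤ) → ℤ) (z : Fin n → ℤ) : ℤ :=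
  sInf ((fun G : (Fin n → ℤ) → ℤ => G z) '' Theta k F)

/-- `p ∈ ℤⁿ` is primitive: the greatest common divisor of its coordinates is `1`. -/
def IsPrimitive {n : ℕ} (p : Fin n → ℤ) : Prop :=
  Finset.univ.gcd p = 1

/-- `Ψ(z) = min(0, p · z)`. -/
def Psi {n : ℕ} (p : Fin n → ℤ) (z : Fin n → ℤ) : ℤ :=
  min 0 (p ⬝ᵥ z)

theorem self_mem_Theta {n : ℕ} (k : ℕ) {F : (Fin n → ℤ) → ℤ} (hF : IsSuperharmonic F) :
    F ∈ Theta k F := by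
  refine ⟨hF, fun z => by omega, fun z => le_refl _, 1, one_pos, ?_⟩
  intro z hz
  exact absurd rfl hz

theorem husking_isLeast {n : ℕ} (k : ℕ) {F : (Fin n → ℤ) → ℤ} (hF : IsSuperharmonic F)
    (z : Fin n → ℤ) :
    IsLeast ((fun G : (Fin n → ℤ) → ℤ => G z) '' Theta k F) (husking k F z) := by
  have hne : ((fun G : (Fin n → ℤ) → ℤ => G z) '' Theta k F).Nonempty :=
    ⟨F z, F, self_mem_Theta k hF, rfl⟩
  have hbd : BddBelow ((fun G : (Fin n → ℤ) → ℤ => G z) '' Theta k F) := by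
    refine ⟨F z - k, ?_⟩
    rintro _ ⟨G, hG, rfl⟩
    exact hG.2.1 z
  exact ⟨Int.csInf_mem hne hbd, fun x hx => csInf_le hbd hx⟩

theorem Psi_isSuperharmonic {n : ℕ} (p : Fin n → ℤ) : IsSuperharmonic (Psi p) := by
  intro z
  have h : ∑ i : Fin n, (Psi p (z + Pi.single i 1) + Psi p (z - Pi.single i 1))
      ≤ ∑ _i : Fin n, 2 * Psi p z := by
    refine Finset.sum_le_sum fun i _ => ?_
    simp only [Psi, dotProduct_add, dotProduct_sub, dotProduct_single_one]
    omega
  simp only [Finset.sum_const, Finset.card_univ, Fintype.card_fin, nsmul_eq_mul] at h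
  unfold laplacian
  linarith

end Sandpile

/-! The minima of a competitor over the hyperplanes `p · z = t` form a function `g` on `ℤ`,
superharmonic for the steps `±pᵢ`, below `min 0 t` and equal to it far away. It suffices to control
all such profiles uniformly (`exists_profile_bound`).

The flux of `g` is a nonincreasing integer between `0` and `|p|² = ∑ pᵢ²`. Together with a Harnack
bound this limits the increments of `g` in terms of `p` only (`exists_profile_gradient_le`). The
flux drops at most `|p|²` times, so near any place `g` is harmonic on a long interval. By pigeonhole
a pattern of increments recurs there, and Liouville's theorem for the periodic continuation of the
increments makes `g` affine on a window (`exists_affine_window`). Liouville's theorem for `g` with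
one side replaced by its affine continuation then gives `g t = t` left of the window or `g = 0`
right of it (`eq_of_affine_window`). As `g ≤ min 0 t`, the first is impossible for a window at
positive `t`, the second for one at negative `t`. Hence `g = min 0 t` outside a fixed interval, and
the gradient bound limits the depth inside it. So the sets `Theta k` stabilise, and the pointwise
minimum of the last one belongs to it. -/

namespace Sandpile

/-! ### Second differences and flux on `ℤ` -/

/-- The second-difference operator on `ℤ` with steps `±pᵢ`. -/
def stepLaplacian {n : ℕ} (p : Fin n → ℤ) (g : ℤ → ℤ) (t : ℤ) : ℤ :=
  ∑ i, (g (t + p i) + g (t - p i) - 2 * g t)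

/-- The flux of `g` through the cut between `t` and `t + 1`. -/
def flux {n : ℕ} (p : Fin n → ℤ) (g : ℤ → ℤ) (t : ℤ) : ℤ :=
  ∑ i, ∑ k ∈ Finset.range (p i).natAbs, (g (t - k + |p i|) - g (t - k))

variable {n : ℕ} {p : Fin n → ℤ} {g : ℤ → ℤ}

theorem stepLaplacian_congr {g' : ℤ → ℤ} {c t : ℤ} (hc : ∀ i, |p i| ≤ c)
    (h : ∀ s, t - c ≤ s → s ≤ t + c → g s = g' s) :
    stepLaplacian p g t = stepLaplacian p g' t := by
  unfold stepLaplacian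
  refine Finset.sum_congr rfl fun i _ => ?_
  have := abs_le.1 (hc i)
  rw [h t (by omega) (by omega), h (t + p i) (by omega) (by omega),
    h (t - p i) (by omega) (by omega)]

theorem stepLaplacian_affine (p : Fin n → ℤ) (a b t : ℤ) :
    stepLaplacian p (fun s => a + b * s) t = 0 :=
  Finset.sum_eq_zero fun i _ => by ring

theorem stepLaplacian_sub (p : Fin n → ℤ) (f g : ℤ → ℤ) (t : ℤ) :
    stepLaplacian p (fun s => f s - g s) t = stepLaplacian p f t - stepLaplacian p g t := by
  unfold stepLaplacian
  rw [← Finset.sum_sub_distrib]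
  exact Finset.sum_congr rfl fun i _ => by ring

theorem stepLaplacian_shift (p : Fin n → ℤ) (g : ℤ → ℤ) (a t : ℤ) :
    stepLaplacian p (fun s => g (s + a)) t = stepLaplacian p g (t + a) := by
  unfold stepLaplacian
  refine Finset.sum_congr rfl fun i _ => ?_
  simp only [show t + p i + a = t + a + p i by ring, show t - p i + a = t + a - p i by ring]

theorem stepLaplacian_neg (p : Fin n → ℤ) (g : ℤ → ℤ) (t : ℤ) :
    stepLaplacian p (fun s => -g s) t = -stepLaplacian p g t := by
  unfold stepLaplacian
  rw [← Finset.sum_neg_distrib]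
  exact Finset.sum_congr rfl fun i _ => by ring

theorem flux_neg (p : Fin n → ℤ) (g : ℤ → ℤ) (t : ℤ) :
    flux p (fun s => -g s) t = -flux p g t := by
  unfold flux
  simp only [← Finset.sum_neg_distrib]
  exact Finset.sum_congr rfl fun i _ => Finset.sum_congr rfl fun k _ => by ring

/-! ### Primitivity, Liouville and Harnack -/

theorem IsPrimitive.exists_dotProduct_eq_one (hp : IsPrimitive p) :
    ∃ u : Fin n → ℤ, p ⬝ᵥ u = 1 := by
  obtain ⟨f, hf⟩ := Finset.gcd_eq_sum_mul Finset.univ p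
  rw [hp] at hf
  exact ⟨f, by rw [hf]; simp [dotProduct]⟩

/-- The steps `±pᵢ` of a primitive vector connect `ℤ`. -/
theorem IsPrimitive.step_induction (hp : IsPrimitive p) {P : ℤ → Prop} (a : ℤ) (ha : P a)
    (hadd : ∀ t i, P t → P (t + p i)) (hsub : ∀ t i, P t → P (t - p i)) (t : ℤ) : P t := by
  obtain ⟨u, hu⟩ := hp.exists_dotProduct_eq_one
  have hmem : t - a ∈ AddSubgroup.closure (Set.range p) := by
    have h1 : (1 : ℤ) ∈ AddSubgroup.closure (Set.range p) := by
      rw [← hu]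
      refine sum_mem fun i _ => ?_
      rw [mul_comm, ← smul_eq_mul]
      exact zsmul_mem (AddSubgroup.subset_closure (Set.mem_range_self i)) _
    simpa using zsmul_mem h1 (t - a)
  have key : ∀ x ∈ AddSubgroup.closure (Set.range p), P (a + x) := by
    intro x hx
    induction hx using AddSubgroup.closure_induction_right with
    | zero => simpa using ha
    | add_right x _ y hy h =>
      obtain ⟨i, rfl⟩ := hy
      rw [← add_assoc]
      exact hadd _ i h
    | add_neg_cancel x _ y hy h =>
      obtain ⟨i, rfl⟩ := hy
      rw [← sub_eq_add_neg, ← add_sub_assoc]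
      exact hsub _ i h
  simpa using key _ hmem

/-- An integer-valued superharmonic function on `ℤ` which is bounded below is constant. -/
theorem IsPrimitive.liouville (hp : IsPrimitive p) (hg : ∀ t, stepLaplacian p g t ≤ 0) {B : ℤ}
    (hB : ∀ t, B ≤ g t) (s t : ℤ) : g s = g t := by
  obtain ⟨m, ⟨a, ha⟩, hm⟩ := Int.exists_least_of_bdd (P := fun x => ∃ t, g t = x)
    ⟨B, by rintro _ ⟨t, rfl⟩; exact hB t⟩ ⟨g 0, 0, rfl⟩
  have hm' : ∀ t, m ≤ g t := fun t => hm _ ⟨t, rfl⟩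
  -- At a minimum every summand of the Laplacian is nonnegative, so all vanish and the minimum
  -- spreads to the neighbours.
  have hnb : ∀ t i, g t = m → g (t + p i) = m ∧ g (t - p i) = m := by
    intro t i ht
    have h0 := hg t
    have h1 : g (t + p i) + g (t - p i) - 2 * g t ≤ stepLaplacian p g t :=
      Finset.single_le_sum (f := fun i => g (t + p i) + g (t - p i) - 2 * g t)
        (fun j _ => by have := hm' (t + p j); have := hm' (t - p j); omega)
        (Finset.mem_univ i)
    have := hm' (t + p i)
    have := hm' (t - p i)
    omega
  have hall : ∀ t, g t = m := hp.step_induction a ha (fun t i h => (hnb t i h).1)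
    fun t i h => (hnb t i h).2
  rw [hall, hall]

/-- A nonnegative function with bounded Laplacian is controlled by its value at one point. -/
theorem IsPrimitive.exists_harnack (hp : IsPrimitive p) (M s : ℤ) :
    ∃ K : ℤ, ∀ D : ℤ → ℤ, (∀ t, 0 ≤ D t) → D 0 = 0 → (∀ t, stepLaplacian p D t ≤ M) →
      D s ≤ K := by
  -- Nonnegativity allows all other neighbours to be dropped, so a bound at `t` passes to `t ± p i`.
  have key : ∀ t i (D : ℤ → ℤ), (∀ t, 0 ≤ D t) → (∀ t, stepLaplacian p D t ≤ M) →
      D (t + p i) + D (t - p i) ≤ M + 2 * n * D t := by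
    intro t i D hD hM
    have h1 : D (t + p i) + D (t - p i) ≤ ∑ i, (D (t + p i) + D (t - p i)) :=
      Finset.single_le_sum (f := fun i => D (t + p i) + D (t - p i))
        (fun j _ => by have := hD (t + p j); have := hD (t - p j); omega)
        (Finset.mem_univ i)
    have h2 := hM t
    unfold stepLaplacian at h2
    rw [Finset.sum_sub_distrib] at h2
    simp only [Finset.sum_const, Finset.card_univ, Fintype.card_fin, nsmul_eq_mul] at h2
    linarith
  refine hp.step_induction (P := fun s => ∃ K : ℤ, ∀ D : ℤ → ℤ, (∀ t, 0 ≤ D t) → D 0 = 0 →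
    (∀ t, stepLaplacian p D t ≤ M) → D s ≤ K) 0 ⟨0, fun D _ h _ => h.le⟩ ?_ ?_ s
  all_goals
    rintro t i ⟨K, hK⟩
    refine ⟨M + 2 * n * K, fun D hD h0 hM => ?_⟩
    have h1 := key t i D hD hM
    have h2 : 2 * (n : ℤ) * D t ≤ 2 * n * K := mul_le_mul_of_nonneg_left (hK D hD h0 hM) (by positivity)
    have := hD (t + p i)
    have := hD (t - p i)
    omega

theorem IsPrimitive.exists_harnack_interval (hp : IsPrimitive p) (M c : ℤ) :
    ∃ K : ℤ, 0 ≤ K ∧ ∀ D : ℤ → ℤ, (∀ t, 0 ≤ D t) → D 0 = 0 →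
      (∀ t, stepLaplacian p D t ≤ M) → ∀ s, -c ≤ s → s ≤ c → D s ≤ K := by
  choose K hK using fun s => hp.exists_harnack M s
  obtain ⟨B, hB⟩ := ((Finset.Icc (-c) c).image K).bddAbove
  refine ⟨max B 0, le_max_right _ _, fun D h1 h2 h3 s hs hs' => ?_⟩
  refine (hK s D h1 h2 h3).trans ((hB ?_).trans (le_max_left _ _))
  exact Finset.mem_coe.2 (Finset.mem_image_of_mem K (Finset.mem_Icc.2 ⟨hs, hs'⟩))

/-! ### Flux and gradient bounds -/

/-- Lowering `t` by one shifts the index `k` by one, so the difference of the two sums telescopes.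
-/
theorem flux_sub_flux (p : Fin n → ℤ) (g : ℤ → ℤ) (t : ℤ) :
    flux p g t - flux p g (t - 1) = stepLaplacian p g t := by
  unfold flux stepLaplacian
  rw [← Finset.sum_sub_distrib]
  refine Finset.sum_congr rfl fun i _ => ?_
  rw [← Finset.sum_sub_distrib]
  have h := Finset.sum_range_sub' (fun k : ℕ => g (t - k + |p i|) - g (t - k)) (p i).natAbs
  have e : ∀ k : ℕ, (g (t - k + |p i|) - g (t - k)) - (g (t - 1 - k + |p i|) - g (t - 1 - k))
      = (g (t - k + |p i|) - g (t - k))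
        - (g (t - ((k + 1 : ℕ) : ℤ) + |p i|) - g (t - ((k + 1 : ℕ) : ℤ))) := by
    intro k
    rw [show t - ((k + 1 : ℕ) : ℤ) = t - 1 - k by push_cast; ring]
  rw [Finset.sum_congr rfl fun k _ => e k, h, Int.natCast_natAbs]
  simp only [Nat.cast_zero, sub_zero, sub_add_cancel]
  rcases abs_choice (p i) with h | h <;> rw [h]
  · ring
  · rw [← sub_eq_add_neg, sub_neg_eq_add]; ring

theorem sub_le_of_forall_diff_le {B a b : ℤ} (hab : a ≤ b)
    (h : ∀ s, a ≤ s → s < b → g (s + 1) - g s ≤ B) : g b - g a ≤ B * (b - a) := by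
  induction b, hab using Int.leInduction with
  | base => simp
  | succ b hb ih =>
    have h1 := ih fun s hs hs' => h s hs (by omega)
    have h2 := h b hb (by omega)
    linarith

/-- For each `i` the flux adds `|p i|` differences over distance `|p i|`, that is, `p i ^ 2` unit
increments, all taken within `c` of `t`. -/
theorem flux_le {c B t : ℤ} (hc : ∀ i, |p i| ≤ c)
    (h : ∀ s, t - c ≤ s → s ≤ t + c → g (s + 1) - g s ≤ B) :
    flux p g t ≤ B * ∑ i, p i ^ 2 := by
  rw [Finset.mul_sum]
  refine Finset.sum_le_sum fun i _ => ?_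
  have hi := hc i
  have h1 : ∀ k ∈ Finset.range (p i).natAbs, g (t - k + |p i|) - g (t - k) ≤ B * |p i| := by
    intro k hk
    have hk : (k : ℤ) < |p i| := by
      rw [← Int.natCast_natAbs]; exact_mod_cast Finset.mem_range.1 hk
    have := sub_le_of_forall_diff_le (g := g) (B := B) (a := t - k) (b := t - k + |p i|)
      (by omega) fun s hs hs' => h s (by omega) (by omega)
    linarith
  refine (Finset.sum_le_sum h1).trans (le_of_eq ?_)
  rw [Finset.sum_const, Finset.card_range, nsmul_eq_mul, Int.natCast_natAbs, ← sq_abs (p i)]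
  ring

theorem le_flux {c B t : ℤ} (hc : ∀ i, |p i| ≤ c)
    (h : ∀ s, t - c ≤ s → s ≤ t + c → B ≤ g (s + 1) - g s) :
    B * ∑ i, p i ^ 2 ≤ flux p g t := by
  have := flux_le (g := fun s => -g s) (B := -B) (t := t) hc fun s h1 h2 => by
    have := h s h1 h2; omega
  rw [flux_neg] at this
  linarith

theorem IsPrimitive.sum_sq_pos (hp : IsPrimitive p) : 0 < ∑ i, p i ^ 2 := by
  obtain ⟨u, hu⟩ := hp.exists_dotProduct_eq_one
  refine lt_of_le_of_ne (Finset.sum_nonneg fun i _ => sq_nonneg _) fun h => ?_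
  have h0 := (Finset.sum_eq_zero_iff_of_nonneg fun i _ => sq_nonneg (p i)).1 h.symm
  have : p ⬝ᵥ u = 0 := Finset.sum_eq_zero fun i hi => by
    rw [pow_eq_zero_iff two_ne_zero |>.1 (h0 i hi), zero_mul]
  omega

/-- A function whose increments are bounded above, whose flux is at most `M`, and whose Laplacian
has increments at least `-M`, has increments bounded above in terms of `p` only. -/
theorem IsPrimitive.exists_gradient_le (hp : IsPrimitive p) :
    ∃ H : ℤ, 0 ≤ H ∧ ∀ g : ℤ → ℤ, (∃ K, ∀ t, g (t + 1) - g t ≤ K) →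
      (∀ t, flux p g t ≤ ∑ i, p i ^ 2) →
      (∀ t, -(∑ i, p i ^ 2) ≤ stepLaplacian p g (t + 1) - stepLaplacian p g t) →
      ∀ t, g (t + 1) - g t ≤ H := by
  have hMpos := hp.sum_sq_pos
  set M := ∑ i, p i ^ 2 with hM
  have hc : ∀ i, |p i| ≤ M := fun i => by
    rw [hM]
    refine le_trans ?_ (Finset.single_le_sum (f := fun i => p i ^ 2)
      (fun j _ => sq_nonneg _) (Finset.mem_univ i))
    simpa using Int.natAbs_le_self_sq (p i)
  obtain ⟨K, hK0, hK⟩ := hp.exists_harnack_interval M M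
  refine ⟨K + 1, by omega, fun g ⟨B, hB⟩ hflux hlap => ?_⟩
  obtain ⟨m, ⟨a, ha⟩, hm⟩ := Int.exists_greatest_of_bdd (P := fun x => ∃ t, g (t + 1) - g t = x)
    ⟨B, by rintro _ ⟨t, rfl⟩; exact hB t⟩ ⟨g (0 + 1) - g 0, 0, rfl⟩
  have hm' : ∀ t, g (t + 1) - g t ≤ m := fun t => hm _ ⟨t, rfl⟩
  -- Harnack for the gap between the largest increment `m`, attained at `a`, and the increment at `s
  -- + a`. The term `0 * s` only fits `stepLaplacian_affine`.
  have hD := hK (fun s => (m + 0 * s) - (g (s + (a + 1)) - g (s + a)))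
    (fun t => by have := hm' (t + a); rw [add_assoc] at this; linarith)
    (by rw [zero_add, zero_add, ha]; ring)
    (fun t => by
      rw [stepLaplacian_sub, stepLaplacian_affine,
        stepLaplacian_sub p (fun s => g (s + (a + 1))) (fun s => g (s + a)),
        stepLaplacian_shift, stepLaplacian_shift]
      have := hlap (t + a)
      rw [add_assoc] at this
      linarith)
  -- All increments near `a` are at least `m - K`, so the flux at `a` is at least `(m - K) * M`;
  -- being at most `M`, it forces `m ≤ K + 1`.
  have h1 := le_flux (p := p) (g := g) (t := a) (B := m - K) hc fun s h1 h2 => by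
    have := hD (s - a) (by omega) (by omega)
    simp only [show s - a + (a + 1) = s + 1 by ring, sub_add_cancel] at this
    linarith
  have h2 := hflux a
  have h3 : m - K ≤ 1 := by
    by_contra! h
    rw [← hM] at h1
    nlinarith
  exact fun t => (hm' t).trans (by omega)

/-! ### Affine windows by recurrence -/

/-- If the increments of `g` over two windows of length `2c` at distance `P` agree and `g` is
harmonic in between, then these increments are constant. -/
theorem IsPrimitive.diff_const_of_recurrence (hp : IsPrimitive p) {c s P : ℤ}
    (hc : ∀ i, |p i| ≤ c) (hP : 0 < P)
    (hrec : ∀ x, 0 ≤ x → x < 2 * c → g (s + x + 1) - g (s + x) = g (s + P + x + 1) - g (s + P + x))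
    (hharm : ∀ t, s + c ≤ t → t ≤ s + c + P → stepLaplacian p g t = 0) :
    ∃ b, ∀ t, s ≤ t → t < s + 2 * c → g (t + 1) - g t = b := by
  set h : ℤ → ℤ := fun t => g (t + 1) - g t with hh
  -- The `P`-periodic continuation of the increments on `[s, s + P)`; by `hrec` it agrees with them
  -- up to `s + P + 2c`.
  set q : ℤ → ℤ := fun t => h (s + (t - s) % P) with hq
  have hmod0 : ∀ x, 0 ≤ x % P := fun x => Int.emod_nonneg x hP.ne'
  have hmod1 : ∀ x, x % P < P := fun x => Int.emod_lt_of_pos x hP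
  have hagree : ∀ m : ℕ, (m : ℤ) < P + 2 * c → h (s + m) = q (s + m) := by
    intro m
    induction m using Nat.strong_induction_on with
    | _ m ih =>
      intro hm
      rcases lt_or_ge (m : ℤ) P with h1 | h1
      · simp only [hq, add_sub_cancel_left, Int.emod_eq_of_lt (Int.natCast_nonneg m) h1]
      · have h2 := ih (m - P.toNat) (by omega) (by omega)
        have h3 : ((m - P.toNat : ℕ) : ℤ) = m - P := by omega
        rw [h3] at h2
        have h4 := hrec (m - P) (by omega) (by omega)
        rw [show s + P + (m - P : ℤ) = s + m by ring] at h4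
        change h (s + (m - P)) = h (s + m) at h4
        rw [← h4, h2]
        simp only [hq, add_sub_cancel_left, Int.sub_emod_right]
  have hagree' : ∀ t, s ≤ t → t < s + P + 2 * c → h t = q t := by
    intro t h1 h2
    have := hagree (t - s).toNat (by omega)
    rwa [show s + ((t - s).toNat : ℤ) = t by omega] at this
  have hper : ∀ t r, q (t + r * P) = q t := by
    intro t r
    simp only [hq]
    rw [show t + r * P - s = t - s + P * r by ring, Int.add_mul_emod_self_left]
  have hqh : ∀ t, stepLaplacian p q t = 0 := by
    intro t
    -- By periodicity `t` may be moved into `[s + c, s + c + P)`, whose `c`-neighbourhood lies where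
    -- `q = h`. Harmonicity of `g` at `t'` and `t' + 1` then suffices.
    set t' := s + c + (t - s - c) % P with ht'
    have h0 := hmod0 (t - s - c)
    have h1 := hmod1 (t - s - c)
    have e : t = t' + (t - s - c) / P * P := by
      have := Int.emod_add_ediv_mul (t - s - c) P
      rw [ht']
      linarith
    rw [e, ← stepLaplacian_shift]
    rw [stepLaplacian_congr (g' := h) hc fun x h2 h3 => by
      rw [hper, hagree' x (by omega) (by omega)]]
    rw [hh, stepLaplacian_sub p (fun x => g (x + 1)) g, stepLaplacian_shift,
      hharm _ (by omega) (by omega), hharm _ (by omega) (by omega), sub_zero]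
  obtain ⟨B, hB⟩ := ((Finset.Ico 0 P).image fun x => h (s + x)).bddBelow
  have hconst := hp.liouville (g := q) (fun t => (hqh t).le) (B := B) fun t => hB <|
    Finset.mem_coe.2 <| Finset.mem_image_of_mem _ <|
      Finset.mem_Ico.2 ⟨hmod0 (t - s), hmod1 (t - s)⟩
  refine ⟨q s, fun t h1 h2 => ?_⟩
  change h t = q s
  rw [hagree' t h1 (by omega), hconst]

/-- A function with increments bounded by `H` is affine on a window of length `2c` inside each
sufficiently long interval on which it is harmonic. -/
theorem IsPrimitive.exists_affine_window (hp : IsPrimitive p) {c : ℤ} (H : ℤ) (hc0 : 0 < c)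
    (hc : ∀ i, |p i| ≤ c) :
    ∃ L : ℤ, 0 < L ∧ ∀ g : ℤ → ℤ, (∀ t, |g (t + 1) - g t| ≤ H) →
      ∀ a, (∀ t, a ≤ t → t < a + L → stepLaplacian p g t = 0) →
        ∃ s b, a ≤ s ∧ s + 2 * c ≤ a + L ∧
          ∀ t, s ≤ t → t < s + 2 * c → g (t + 1) - g t = b := by
  -- The finitely many possible patterns of `2c` consecutive increments; two of `card S + 1`
  -- starting points must share one.
  let S := Fin (2 * c).toNat → Finset.Icc (-H) H
  refine ⟨Fintype.card S + 2 * c + 1, by positivity, fun g hg a hharm => ?_⟩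
  let f : Fin (Fintype.card S + 1) → S := fun j x =>
    ⟨g (a + j + x + 1) - g (a + j + x), Finset.mem_Icc.2 (abs_le.1 (hg _))⟩
  obtain ⟨i, j, hij, hf⟩ := Fintype.exists_ne_map_eq_of_card_lt f (by simp)
  wlog hlt : i < j generalizing i j
  · exact this j i hij.symm hf.symm (lt_of_le_of_ne (not_lt.1 hlt) hij.symm)
  have hlt' : (i : ℤ) < j := by exact_mod_cast hlt
  have hj : (j : ℤ) ≤ Fintype.card S := by exact_mod_cast Nat.lt_succ_iff.1 j.2
  obtain ⟨b, hb⟩ := hp.diff_const_of_recurrence (g := g) (s := a + i) (P := j - i) hc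
    (by omega) (fun x h0 h1 => by
      have := congrArg Subtype.val (congrFun hf ⟨x.toNat, by omega⟩)
      simp only [f, Int.toNat_of_nonneg h0] at this
      rw [this, show a + (i : ℤ) + (j - i) + x = a + j + x by ring])
    (fun t h0 h1 => hharm t (by omega) (by omega))
  exact ⟨a + i, b, by omega, by omega, hb⟩

/-! ### One-dimensional profiles -/

/-- The superharmonic functions on `ℤ` (for the steps `±pᵢ`) below `min 0 t` which coincide
with it far away. -/
structure IsProfile {n : ℕ} (p : Fin n → ℤ) (g : ℤ → ℤ) : Prop where
  superharmonic : ∀ t, stepLaplacian p g t ≤ 0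
  le : ∀ t, g t ≤ min 0 t
  bounded : ∃ K : ℤ, 0 ≤ K ∧ ∀ t, min 0 t - K ≤ g t
  far : ∃ R : ℤ, 0 ≤ R ∧ ∀ t, R ≤ |t| → g t = min 0 t

theorem exists_abs_le (p : Fin n → ℤ) : ∃ c : ℤ, 0 < c ∧ ∀ i, |p i| ≤ c :=
  ⟨∑ i, |p i| + 1, by positivity, fun i => by
    have := Finset.single_le_sum (f := fun i => |p i|) (fun j _ => abs_nonneg (p j))
      (Finset.mem_univ i)
    omega⟩

namespace IsProfile

theorem flux_antitone (hg : IsProfile p g) : Antitone (flux p g) := by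
  refine antitone_int_of_succ_le fun t => ?_
  have h := flux_sub_flux p g (t + 1)
  have := hg.superharmonic (t + 1)
  rw [add_sub_cancel_right] at h
  omega

/-- Far right the slope is `0`, far left it is `1`; monotonicity carries the resulting flux bounds
to every `t`. -/
theorem flux_mem (hg : IsProfile p g) (t : ℤ) : 0 ≤ flux p g t ∧ flux p g t ≤ ∑ i, p i ^ 2 := by
  obtain ⟨R, hR0, hR⟩ := hg.far
  obtain ⟨c, hc0, hc⟩ := exists_abs_le p
  constructor
  · refine le_trans ?_ (hg.flux_antitone (le_max_left t (R + c)))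
    have := le_flux (p := p) (g := g) (t := max t (R + c)) (B := 0) hc fun s h1 h2 => by
      have := le_max_right t (R + c)
      rw [hR s (by rw [abs_of_nonneg] <;> omega), hR (s + 1) (by rw [abs_of_nonneg] <;> omega)]
      omega
    linarith
  · refine (hg.flux_antitone (min_le_left t (-(R + c + 1)))).trans ?_
    have := flux_le (p := p) (g := g) (t := min t (-(R + c + 1))) (B := 1) hc fun s h1 h2 => by
      have := min_le_right t (-(R + c + 1))
      rw [hR s (by rw [abs_of_nonpos] <;> omega), hR (s + 1) (by rw [abs_of_nonpos] <;> omega)]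
      omega
    linarith

theorem neg_le_stepLaplacian (hg : IsProfile p g) (t : ℤ) :
    -(∑ i, p i ^ 2) ≤ stepLaplacian p g t := by
  have := flux_sub_flux p g t
  have := hg.flux_mem t
  have := hg.flux_mem (t - 1)
  omega

/-- On an affine window the profile has slope `1` or `0`, and then nothing happens on the left,
respectively on the right. -/
theorem eq_of_affine_window (hg : IsProfile p g) (hp : IsPrimitive p) {c s b : ℤ} (hc0 : 0 < c)
    (hc : ∀ i, |p i| ≤ c) (hb : ∀ t, s ≤ t → t < s + 2 * c → g (t + 1) - g t = b) :
    (∀ t ≤ s + 2 * c, g t = t) ∨ ∀ t, s ≤ t → g t = 0 := by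
  obtain ⟨R, hR0, hR⟩ := hg.far
  obtain ⟨K, hK0, hK⟩ := hg.bounded
  have hlin : ∀ t, s ≤ t → t ≤ s + 2 * c → g t = (g s - b * s) + b * t := by
    intro t h1 h2
    induction t, h1 using Int.leInduction with
    | base => ring
    | succ t ht ih =>
      have := ih (by omega)
      have := hb t ht (by omega)
      linarith
  rcases le_or_gt b 0 with hb0 | hb0
  · right
    -- Continuing the affine piece to the left with slope `b ≤ 0` keeps `u` superharmonic and makes
    -- it bounded below. The window length `2c` ensures that each Laplacian sees only `g` or only
    -- the affine function.
    set u : ℤ → ℤ := fun t => if s ≤ t then g t else (g s - b * s) + b * t with hu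
    have hsup : ∀ t, stepLaplacian p u t ≤ 0 := by
      intro t
      rcases le_or_gt (s + c) t with h | h
      · rw [stepLaplacian_congr (g' := g) hc fun x h1 h2 => if_pos (by omega)]
        exact hg.superharmonic t
      · rw [stepLaplacian_congr (g' := fun x => (g s - b * s) + b * x) hc fun x h1 h2 => ?_,
          stepLaplacian_affine]
        by_cases hx : s ≤ x
        · simp only [hu, if_pos hx]
          exact hlin x hx (by omega)
        · simp only [hu, if_neg hx]
    have hconst := hp.liouville hsup (B := min 0 s - K) fun t => by
      simp only [hu]
      split_ifs with h
      · have := hK t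
        omega
      · have := hK s
        nlinarith
    intro t ht
    have h1 := hconst t (max t R)
    simp only [hu, if_pos ht, if_pos (ht.trans (le_max_left t R))] at h1
    have := le_max_right t R
    rw [h1, hR _ (by rw [abs_of_nonneg] <;> omega)]
    omega
  · left
    -- The mirror case: continue to the right with slope `b ≥ 1` and subtract `t`, so that the
    -- continuation has slope `b - 1 ≥ 0`.
    set u : ℤ → ℤ := fun t => if t ≤ s + 2 * c then g t else (g s - b * s) + b * t with hu
    have hsup : ∀ t, stepLaplacian p (fun t => u t - (0 + 1 * t)) t ≤ 0 := by
      intro t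
      rw [stepLaplacian_sub, stepLaplacian_affine, sub_zero]
      rcases le_or_gt t (s + c) with h | h
      · rw [stepLaplacian_congr (g' := g) hc fun x h1 h2 => if_pos (by omega)]
        exact hg.superharmonic t
      · rw [stepLaplacian_congr (g' := fun x => (g s - b * s) + b * x) hc fun x h1 h2 => ?_,
          stepLaplacian_affine]
        by_cases hx : x ≤ s + 2 * c
        · simp only [hu, if_pos hx]
          exact hlin x (by omega) hx
        · simp only [hu, if_neg hx]
    have hconst := hp.liouville hsup (B := min (min 0 (-(s + 2 * c)) - K) (min 0 s - K - s))
      fun t => by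
        simp only [hu]
        split_ifs with h
        · have := hK t
          omega
        · have := hK s
          have : (b - 1) * (t - s) ≥ 0 := mul_nonneg (by omega) (by omega)
          have : min (min 0 (-(s + 2 * c)) - K) (min 0 s - K - s) ≤ min 0 s - K - s :=
            min_le_right _ _
          linarith
    intro t ht
    have h1 := hconst t (min t (-R))
    simp only [hu, if_pos ht, if_pos ((min_le_left t (-R)).trans ht)] at h1
    have := min_le_right t (-R)
    rw [hR (min t (-R)) (by rw [abs_of_nonpos] <;> omega)] at h1
    omega

end IsProfile

/-- `exists_gradient_le` applies to both `g` and `-g`, because the Laplacian of `g` takes values in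
`[-|p|², 0]`. -/
theorem IsPrimitive.exists_profile_gradient_le (hp : IsPrimitive p) :
    ∃ H : ℤ, 0 ≤ H ∧ ∀ g, IsProfile p g → ∀ t, |g (t + 1) - g t| ≤ H := by
  obtain ⟨H, hH0, hH⟩ := hp.exists_gradient_le
  refine ⟨H, hH0, fun g hg t => ?_⟩
  obtain ⟨K, hK0, hK⟩ := hg.bounded
  have hM := hp.sum_sq_pos
  rw [abs_le]
  constructor
  · have := hH (fun s => -g s) ⟨K, fun t => by have := hK (t + 1); have := hg.le t; omega⟩
      (fun t => by have := hg.flux_mem t; rw [flux_neg]; omega)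
      (fun t => by
        have := hg.neg_le_stepLaplacian t
        have := hg.superharmonic (t + 1)
        rw [stepLaplacian_neg, stepLaplacian_neg]
        omega) t
    linarith
  · exact hH g ⟨K + 1, fun t => by have := hK t; have := hg.le (t + 1); omega⟩
      (fun t => (hg.flux_mem t).2)
      (fun t => by
        have := hg.neg_le_stepLaplacian (t + 1)
        have := hg.superharmonic t
        omega) t

/-- Every sufficiently long interval contains a window on which a profile is affine. -/
theorem IsPrimitive.exists_profile_window (hp : IsPrimitive p) :
    ∃ W : ℤ, 0 < W ∧ ∀ g, IsProfile p g → ∀ a, ∃ s, a ≤ s ∧ s < a + W ∧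
      ((∀ t ≤ s, g t = t) ∨ ∀ t, s ≤ t → g t = 0) := by
  obtain ⟨H, hH0, hH⟩ := hp.exists_profile_gradient_le
  obtain ⟨c, hc0, hc⟩ := exists_abs_le p
  obtain ⟨L, hL0, hL⟩ := hp.exists_affine_window H hc0 hc
  have hM := hp.sum_sq_pos
  refine ⟨(∑ i, p i ^ 2 + 1) * L, by positivity, fun g hg a => ?_⟩
  by_contra! hcon
  -- Without a good window, the flux must drop on each block of length `L`, since constant flux
  -- means harmonicity there. After `|p|² + 1` blocks it would be negative.
  have hdrop : ∀ m : ℕ, (m : ℤ) ≤ ∑ i, p i ^ 2 + 1 →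
      flux p g (a + m * L - 1) ≤ ∑ i, p i ^ 2 - m := by
    intro m
    induction m with
    | zero => intro _; simpa using (hg.flux_mem (a - 1)).2
    | succ m ih =>
      intro hm
      push_cast at hm ⊢
      have ih := ih (by omega)
      by_contra! hlt
      have hmL : ((m : ℤ) + 1) * L ≤ (∑ i, p i ^ 2 + 1) * L :=
        mul_le_mul_of_nonneg_right hm hL0.le
      have hmL0 : 0 ≤ (m : ℤ) * L := by positivity
      rw [add_mul, one_mul] at hmL
      rw [add_mul (m : ℤ), one_mul] at hlt
      obtain ⟨s, b, h1, h2, h3⟩ := hL g (hH g hg) (a + m * L) fun t h1 h2 => by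
        have e := flux_sub_flux p g t
        have := hg.flux_antitone (show t ≤ a + (m * L + L) - 1 by omega)
        have := hg.flux_antitone (show a + m * L - 1 ≤ t - 1 by omega)
        have := hg.superharmonic t
        omega
      have hs := hcon s (by omega) (by omega)
      rcases hg.eq_of_affine_window hp hc0 hc h3 with h4 | h4
      · obtain ⟨t, ht, ht'⟩ := hs.1
        exact ht' (h4 t (by omega))
      · obtain ⟨t, ht, ht'⟩ := hs.2
        exact ht' (h4 t ht)
  have h1 := hdrop (∑ i, p i ^ 2 + 1).toNat (by omega)
  rw [Int.toNat_of_nonneg (by omega)] at h1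
  have := (hg.flux_mem (a + (∑ i, p i ^ 2 + 1) * L - 1)).1
  omega

/-- Profiles differ from `min 0 t` by a bounded amount on a bounded set, uniformly. -/
theorem IsPrimitive.exists_profile_bound (hp : IsPrimitive p) :
    ∃ W N : ℤ, 0 < W ∧ 0 < N ∧ ∀ g, IsProfile p g →
      (∀ t, W ≤ |t| → g t = min 0 t) ∧ ∀ t, min 0 t - N ≤ g t := by
  obtain ⟨H, hH0, hH⟩ := hp.exists_profile_gradient_le
  obtain ⟨W, hW0, hW⟩ := hp.exists_profile_window
  -- The depth is measured from `g (-W) = -W`, with at most `2 * W` steps each losing at most `H`.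
  refine ⟨W, W + H * (2 * W), hW0, by positivity, fun g hg => ?_⟩
  have hfar : ∀ t, W ≤ |t| → g t = min 0 t := by
    intro t ht
    rcases le_or_gt 0 t with h0 | h0
    · rw [abs_of_nonneg h0] at ht
      -- Starting at `1` makes `s > 0`, so `g s = s` contradicts `g s ≤ 0`; below, starting at `-W`
      -- makes `s < 0` and excludes `g s = 0`.
      obtain ⟨s, h1, h2, h3 | h3⟩ := hW g hg 1
      · have := h3 s le_rfl
        have := hg.le s
        omega
      · rw [h3 t (by omega)]
        omega
    · rw [abs_of_neg h0] at ht
      obtain ⟨s, h1, h2, h3 | h3⟩ := hW g hg (-W)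
      · rw [h3 t (by omega)]
        omega
      · have := h3 s le_rfl
        have := hg.le s
        omega
  refine ⟨hfar, fun t => ?_⟩
  rcases le_or_gt W |t| with h | h
  · rw [hfar t h]
    have : 0 ≤ H * (2 * W) := by positivity
    omega
  · have h' := abs_lt.1 h
    have h1 := sub_le_of_forall_diff_le (g := fun s => -g s) (B := H) h'.1.le fun s _ _ => by
      have := (abs_le.1 (hH g hg s)).1
      linarith
    have h2 : H * (t - -W) ≤ H * (2 * W) := mul_le_mul_of_nonneg_left (by omega) hH0
    have h3 := hfar (-W) (by rw [abs_neg, abs_of_pos hW0])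
    omega

/-! ### From `ℤⁿ` to profiles -/

theorem abs_dotProduct_sub_le (p z a : Fin n → ℤ) :
    |((p ⬝ᵥ z - p ⬝ᵥ a : ℤ) : ℝ)| ≤
      (∑ i, |(p i : ℝ)|) * Real.sqrt (∑ i, ((z i : ℝ) - (a i : ℝ)) ^ 2) := by
  rw [← dotProduct_sub, dotProduct, Int.cast_sum, Finset.sum_mul]
  refine (Finset.abs_sum_le_sum_abs _ _).trans (Finset.sum_le_sum fun i _ => ?_)
  rw [Int.cast_mul, abs_mul]
  refine mul_le_mul_of_nonneg_left ?_ (abs_nonneg _)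
  refine Real.abs_le_sqrt ?_
  rw [Pi.sub_apply, Int.cast_sub]
  exact Finset.single_le_sum (f := fun i => ((z i : ℝ) - (a i : ℝ)) ^ 2)
    (fun j _ => sq_nonneg _) (Finset.mem_univ i)

theorem laplacian_eq_sum (F : (Fin n → ℤ) → ℤ) (z : Fin n → ℤ) :
    laplacian F z = ∑ i, (F (z + Pi.single i 1) + F (z - Pi.single i 1) - 2 * F z) := by
  unfold laplacian
  rw [Finset.sum_sub_distrib]
  simp only [Finset.sum_const, Finset.card_univ, Fintype.card_fin, nsmul_eq_mul]
  ring

theorem abs_dotProduct_le_of_mem_deviationSet {c : ℤ} (hc : ∀ i, |p i| ≤ c) {a : Fin n → ℤ}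
    (ha : a ∈ deviationSet (Psi p)) : |p ⬝ᵥ a| ≤ c := by
  by_contra! h
  refine ha ?_
  rw [laplacian_eq_sum]
  refine Finset.sum_eq_zero fun i _ => ?_
  simp only [Psi, dotProduct_add, dotProduct_sub, dotProduct_single_one]
  have := abs_le.1 (hc i)
  rcases lt_abs.1 h with h | h <;> omega

theorem IsPrimitive.mem_deviationSet (hp : IsPrimitive p) {a : Fin n → ℤ} (ha : p ⬝ᵥ a = 0) :
    a ∈ deviationSet (Psi p) := by
  intro h
  rw [laplacian_eq_sum] at h
  have hle : ∀ i, Psi p (a + Pi.single i 1) + Psi p (a - Pi.single i 1) - 2 * Psi p a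
      = -|p i| := fun i => by
    simp only [Psi, dotProduct_add, dotProduct_sub, dotProduct_single_one, ha]
    rcases abs_cases (p i) with h | h <;> omega
  rw [Finset.sum_congr rfl fun i _ => hle i, Finset.sum_neg_distrib, neg_eq_zero,
    Finset.sum_eq_zero_iff_of_nonneg fun i _ => abs_nonneg (p i)] at h
  have := hp.sum_sq_pos
  rw [Finset.sum_eq_zero fun i hi => by rw [abs_eq_zero.1 (h i hi)]; ring] at this
  exact lt_irrefl _ this

/-- Coinciding at infinity with `Psi p` means coinciding outside a strip. -/
theorem IsPrimitive.agreesAtInfinity_iff (hp : IsPrimitive p) {G : (Fin n → ℤ) → ℤ} :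
    AgreesAtInfinity (Psi p) G ↔ ∃ R : ℤ, 0 ≤ R ∧ ∀ z, R ≤ |p ⬝ᵥ z| → G z = Psi p z := by
  constructor
  · rintro ⟨C, hC0, hC⟩
    obtain ⟨c, hc0, hc⟩ := exists_abs_le p
    obtain ⟨m, hm⟩ := exists_nat_gt ((∑ i, |(p i : ℝ)|) * C)
    refine ⟨m + c, by positivity, fun z hz => ?_⟩
    by_contra hne
    obtain ⟨a, ha, hd⟩ := hC (show z ∈ {z | Psi p z ≠ G z} from fun h => hne h.symm)
    have h1 := abs_dotProduct_le_of_mem_deviationSet hc ha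
    have h2 := (abs_dotProduct_sub_le p z a).trans
      (mul_le_mul_of_nonneg_left hd (Finset.sum_nonneg fun i _ => abs_nonneg _))
    have h3 : |p ⬝ᵥ z - p ⬝ᵥ a| < m := by exact_mod_cast h2.trans_lt hm
    have := abs_sub_abs_le_abs_sub (p ⬝ᵥ z) (p ⬝ᵥ a)
    omega
  · rintro ⟨R, hR0, hR⟩
    obtain ⟨u, hu⟩ := hp.exists_dotProduct_eq_one
    -- Moving `z` along `u` to the hyperplane `p · z = 0`, which lies in the deviation set, costs
    -- `|p · z|` times the length of `u`; the `1` makes the radius positive.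
    refine ⟨R * Real.sqrt (∑ i, (u i : ℝ) ^ 2) + 1, by positivity, fun z hz => ?_⟩
    have hzR : |p ⬝ᵥ z| < R := by
      by_contra! h
      exact hz (hR z h).symm
    refine ⟨z - (p ⬝ᵥ z) • u, hp.mem_deviationSet ?_, ?_⟩
    · rw [dotProduct_sub, dotProduct_smul, hu, smul_eq_mul, mul_one, sub_self]
    · have e : ∑ i, ((z i : ℝ) - ((z - (p ⬝ᵥ z) • u) i : ℤ)) ^ 2
          = ((p ⬝ᵥ z : ℤ) : ℝ) ^ 2 * ∑ i, (u i : ℝ) ^ 2 := by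
        rw [Finset.mul_sum]
        refine Finset.sum_congr rfl fun i _ => ?_
        rw [Pi.sub_apply, Pi.smul_apply, smul_eq_mul]
        push_cast
        ring
      rw [e, Real.sqrt_mul (sq_nonneg _), Real.sqrt_sq_eq_abs]
      have : |((p ⬝ᵥ z : ℤ) : ℝ)| ≤ R := by exact_mod_cast hzR.le
      have := mul_le_mul_of_nonneg_right this (Real.sqrt_nonneg (∑ i, (u i : ℝ) ^ 2))
      linarith

/-- The minima of a competitor over the hyperplanes `p · z = t` form a profile. -/
theorem IsPrimitive.exists_isProfile (hp : IsPrimitive p) {k : ℕ} {G : (Fin n → ℤ) → ℤ}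
    (hG : G ∈ Theta k (Psi p)) : ∃ g, IsProfile p g ∧ ∀ z, g (p ⬝ᵥ z) ≤ G z := by
  obtain ⟨hsup, hlow, hup, hagree⟩ := hG
  obtain ⟨R, hR0, hR⟩ := hp.agreesAtInfinity_iff.1 hagree
  obtain ⟨u, hu⟩ := hp.exists_dotProduct_eq_one
  have hex : ∀ t : ℤ, ∃ z, p ⬝ᵥ z = t ∧ ∀ z', p ⬝ᵥ z' = t → G z ≤ G z' := by
    intro t
    obtain ⟨m, ⟨z, hz, hzm⟩, hm⟩ := Int.exists_least_of_bdd
      (P := fun x => ∃ z, p ⬝ᵥ z = t ∧ G z = x)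
      ⟨min 0 t - k, by rintro _ ⟨z, rfl, rfl⟩; exact hlow z⟩
      ⟨G (t • u), t • u, by rw [dotProduct_smul, hu, smul_eq_mul, mul_one], rfl⟩
    exact ⟨z, hz, fun z' hz' => hzm ▸ hm _ ⟨z', hz', rfl⟩⟩
  choose ζ hζ hmin using hex
  have hPsi : ∀ t, Psi p (ζ t) = min 0 t := fun t => by rw [Psi, hζ]
  refine ⟨fun t => G (ζ t), ⟨fun t => ?_, fun t => ?_, ⟨k, by positivity, fun t => ?_⟩,
    ⟨R, hR0, fun t ht => ?_⟩⟩, fun z => hmin _ z rfl⟩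
  -- At the minimiser `ζ t` the values agree, while its neighbours lie on the hyperplanes `t ± p i`,
  -- where the minima are at most `G`.
  · refine le_trans ?_ (hsup (ζ t))
    rw [laplacian_eq_sum]
    refine Finset.sum_le_sum fun i _ => ?_
    have h1 := hmin (t + p i) (ζ t + Pi.single i 1)
      (by rw [dotProduct_add, dotProduct_single_one, hζ])
    have h2 := hmin (t - p i) (ζ t - Pi.single i 1)
      (by rw [dotProduct_sub, dotProduct_single_one, hζ])
    simp only
    omega
  · simpa only [hPsi] using hup (ζ t)
  · simpa only [hPsi] using hlow (ζ t)
  · rw [← hPsi]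
    exact hR _ (by rw [hζ]; exact ht)

/-! ### Stabilisation and minimality of the husking -/

theorem Theta_mono {k l : ℕ} (h : k ≤ l) (F : (Fin n → ℤ) → ℤ) : Theta k F ⊆ Theta l F :=
  fun _ ⟨h1, h2, h3, h4⟩ => ⟨h1, fun z => by have := h2 z; omega, h3, h4⟩

/-- All competitors, whatever `k`, are uniformly close to `Psi p` and coincide with it outside
one strip. -/
theorem IsPrimitive.exists_theta_bound (hp : IsPrimitive p) :
    ∃ (R : ℤ) (N : ℕ), 0 ≤ R ∧ 0 < N ∧ ∀ k, ∀ G ∈ Theta k (Psi p),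
      G ∈ Theta N (Psi p) ∧ ∀ z, R ≤ |p ⬝ᵥ z| → G z = Psi p z := by
  obtain ⟨W, N, hW, hN, h⟩ := hp.exists_profile_bound
  refine ⟨W, N.toNat, hW.le, by omega, fun k G hG => ?_⟩
  obtain ⟨g, hg, hgG⟩ := hp.exists_isProfile hG
  obtain ⟨hfar, hlow⟩ := h g hg
  refine ⟨⟨hG.1, fun z => ?_, hG.2.2.1, hG.2.2.2⟩, fun z hz => le_antisymm (hG.2.2.1 z) ?_⟩
  · have := hlow (p ⬝ᵥ z)
    have := hgG z
    simp only [Psi]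
    omega
  · have := hfar _ hz
    have := hgG z
    simp only [Psi]
    omega

theorem husking_le {k : ℕ} {F G : (Fin n → ℤ) → ℤ} (hF : IsSuperharmonic F)
    (hG : G ∈ Theta k F) : husking k F ≤ G :=
  fun z => (husking_isLeast k hF z).2 ⟨G, hG, rfl⟩

/-- At each `z` some `G` in `Theta k F` attains the minimum and lies above the husking at the
neighbours. -/
theorem husking_isSuperharmonic {F : (Fin n → ℤ) → ℤ} (k : ℕ) (hF : IsSuperharmonic F) :
    IsSuperharmonic (husking k F) := by
  intro z
  obtain ⟨G, hG, hGz⟩ := (husking_isLeast k hF z).1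
  refine le_trans ?_ (hG.1 z)
  rw [laplacian_eq_sum, laplacian_eq_sum]
  refine Finset.sum_le_sum fun i _ => ?_
  have h1 : husking k F (z + Pi.single i 1) ≤ G (z + Pi.single i 1) := husking_le hF hG _
  have h2 : husking k F (z - Pi.single i 1) ≤ G (z - Pi.single i 1) := husking_le hF hG _
  simp only at hGz
  omega

theorem IsSuperharmonic.inf {F G : (Fin n → ℤ) → ℤ} (hF : IsSuperharmonic F)
    (hG : IsSuperharmonic G) : IsSuperharmonic (F ⊓ G) := by
  intro z
  rcases le_total (F z) (G z) with h | h
  · refine le_trans ?_ (hF z)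
    rw [laplacian_eq_sum, laplacian_eq_sum]
    refine Finset.sum_le_sum fun i _ => ?_
    have h1 : (F ⊓ G) (z + Pi.single i 1) ≤ F (z + Pi.single i 1) := inf_le_left
    have h2 : (F ⊓ G) (z - Pi.single i 1) ≤ F (z - Pi.single i 1) := inf_le_left
    have h3 : (F ⊓ G) z = F z := inf_eq_left.2 h
    omega
  · refine le_trans ?_ (hG z)
    rw [laplacian_eq_sum, laplacian_eq_sum]
    refine Finset.sum_le_sum fun i _ => ?_
    have h1 : (F ⊓ G) (z + Pi.single i 1) ≤ G (z + Pi.single i 1) := inf_le_right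
    have h2 : (F ⊓ G) (z - Pi.single i 1) ≤ G (z - Pi.single i 1) := inf_le_right
    have h3 : (F ⊓ G) z = G z := inf_eq_right.2 h
    omega

end Sandpile

theorem mainTheorem2 {n : ℕ} (p : Fin n → ℤ) (hp : Sandpile.IsPrimitive p) :
    ∃ N : ℕ, 0 < N ∧
      (∀ k : ℕ, N < k → Sandpile.husking k (Sandpile.Psi p) =
        Sandpile.husking N (Sandpile.Psi p)) ∧
      Sandpile.AgreesAtInfinity (Sandpile.Psi p) (Sandpile.husking N (Sandpile.Psi p)) ∧
      IsLeast (⋃ k : ℕ, Sandpile.Theta k (Sandpile.Psi p))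
        (Sandpile.husking N (Sandpile.Psi p)) ∧
      IsLeast {G : (Fin n → ℤ) → ℤ | Sandpile.IsSuperharmonic G ∧
          Sandpile.AgreesAtInfinity (Sandpile.Psi p) G ∧
          ∃ k : ℕ, ∀ z, Sandpile.Psi p z - (k : ℤ) ≤ G z}
        (Sandpile.husking N (Sandpile.Psi p)) := by
  obtain ⟨R, N, hR0, hN, h⟩ := hp.exists_theta_bound
  have hΨ := Sandpile.Psi_isSuperharmonic p
  have hagree : Sandpile.AgreesAtInfinity (Sandpile.Psi p)
      (Sandpile.husking N (Sandpile.Psi p)) := by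
    refine hp.agreesAtInfinity_iff.2 ⟨R, hR0, fun z hz => ?_⟩
    obtain ⟨G, hG, hGz⟩ := (Sandpile.husking_isLeast N hΨ z).1
    exact hGz ▸ (h N G hG).2 z hz
  have hmem : Sandpile.husking N (Sandpile.Psi p) ∈ Sandpile.Theta N (Sandpile.Psi p) := by
    refine ⟨Sandpile.husking_isSuperharmonic N hΨ, fun z => ?_,
      Sandpile.husking_le hΨ (Sandpile.self_mem_Theta N hΨ), hagree⟩
    obtain ⟨G, hG, hGz⟩ := (Sandpile.husking_isLeast N hΨ z).1
    exact hGz ▸ hG.2.1 z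
  have hleast : ∀ k, ∀ G ∈ Sandpile.Theta k (Sandpile.Psi p),
      Sandpile.husking N (Sandpile.Psi p) ≤ G := fun k G hG =>
    Sandpile.husking_le hΨ (h k G hG).1
  refine ⟨N, hN, fun k hk => ?_, hagree, ⟨Set.mem_iUnion.2 ⟨N, hmem⟩, fun G hG => ?_⟩,
    ⟨⟨hmem.1, hagree, N, hmem.2.1⟩, ?_⟩⟩
  · have : Sandpile.Theta k (Sandpile.Psi p) = Sandpile.Theta N (Sandpile.Psi p) :=
      Set.Subset.antisymm (fun G hG => (h k G hG).1) (Sandpile.Theta_mono hk.le _)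
    funext z
    rw [Sandpile.husking, Sandpile.husking, this]
  · obtain ⟨k, hk⟩ := Set.mem_iUnion.1 hG
    exact hleast k G hk
  · rintro G ⟨hsup, hG, k, hk⟩
    -- `G` need not lie below `Psi p`; its infimum with `Psi p` does, and belongs to `Theta k`.
    refine le_trans (hleast k (Sandpile.Psi p ⊓ G) ⟨hΨ.inf hsup, fun z => ?_,
      fun z => inf_le_left, ?_⟩) inf_le_right
    · exact le_inf (by omega) (hk z)
    · obtain ⟨C, hC0, hC⟩ := hG
      refine ⟨C, hC0, fun z hz => hC fun hz' => hz ?_⟩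
      rw [Pi.inf_apply, ← hz', inf_idem]
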